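/- Let $n\ge 3$, let $K$ be a field, let $S=K[x_1,\ldots,x_n]$ and $T=S[y_1,\ldots,y_n]$, with all indices taken modulo $n$. Let $I=I_{n-2}(C_n)\subset S$ be the $(n-2)$-path ideal of the $n$-cycle $C_n$, i.e. the ideal generated by the products of the variables along the paths of $C_n$ with $n-2$ vertices. Then $I$ is generated by $u_j=x_jx_{j+1}\cdots x_{j+n-3}$, $j=1,\ldots,n$. Let $R(I)=S[u_1s,\ldots,u_ns]\subset S[s]$ be its Rees algebra, let $\varphi:T\to R(I)$ be the surjective $S$-algebra homomorphism with $\varphi(y_j)=u_js$, and let $J=\operatorname{Ker}\varphi$ be the defining ideal of $R(I)$. Let $L\subset T$ be the defining ideal of the symmetric algebra of $I$, i.e. the ideal generated by all $\sum_j a_jy_j$ with $a_j\in S$ and $\sum_j a_ju_j=0$. Let $H\subset K[y_1,\ldots,y_n]$ be the ideal of fiber relations of $I$, i.e. the kernel of the $K$-algebra homomorphism from $K[y_1,\ldots,y_n]$ to the fiber cone $R(I)/\mathfrak m R(I)$, $\mathfrak m=(x_1,\ldots,x_n)$, that sends $y_j$ to the class of $u_js$. Then: 1. $L=(f_1,\ldots,f_n)$,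 where $f_j=x_{n-2+j}\,y_j-x_j\,y_{j+1}$ for $j=1,\ldots,n$. 2. If $n$ is odd, then $J=L$; that is, $I$ is of linear type. 3. If $n$ is even, then $H=(h)$, where $h=\prod_{i=0}^{n/2-1}y_{2i}-\prod_{i=0}^{n/2-1}y_{2i+1}$, and $J=L+HT$; that is, $I$ is of fiber type. -/

import Mathlib

open MvPolynomial

noncomputable section

/-- The `t`-path ideal `I_t(G)` of a graph `G`: the ideal of `K[x_v | v ∈ V]` generated by the
monomials `x_{i_1} ⋯ x_{i_t}` such that `i_1, …, i_t` is a path of `G` (on `t` vertices). -/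
def pathIdeal (K : Type*) [Field K] {V : Type*} (G : SimpleGraph V) (t : ℕ) :
    Ideal (MvPolynomial V K) :=
  Ideal.span {m | ∃ (v w : V) (p : G.Walk v w),
    p.IsPath ∧ p.support.length = t ∧ m = (p.support.map X).prod}

/-- The monomial `u_j = x_j x_{j+1} ⋯ x_{j+t-1}`, indices modulo `n`. -/
def cyclePathMonomial (K : Type*) [Field K] (n : ℕ) [NeZero n] (t : ℕ) (j : Fin n) :
    MvPolynomial (Fin n) K :=
  ∏ k ∈ Finset.range t, X (Fin.ofNat n (j.val + k))

section Rees

variable {ι S : Type*} [CommRing S]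

/-- The element `u_j s`, an element of degree one of the Rees algebra `R(I) ⊆ S[s]` of the ideal
`I` generated by the family `u`. -/
def reesGen (u : ι → S) (j : ι) : reesAlgebra (Ideal.span (Set.range u)) :=
  ⟨Polynomial.monomial 1 (u j), reesAlgebra.monomial_mem.mpr
    (by rw [pow_one]; exact Ideal.subset_span ⟨j, rfl⟩)⟩

/-- The natural map `φ : T = S[y_j | j ∈ ι] → R(I)`, `y_j ↦ u_j s`, where `I` is the ideal
generated by the family `u`. -/
def reesMap (u : ι → S) :
    MvPolynomial ι S →ₐ[S] reesAlgebra (Ideal.span (Set.range u)) :=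
  aeval (reesGen u)

/-- The map `φ` is surjective, so that `R(I)` is the quotient of `T` by its kernel. -/
theorem reesMap_surjective (u : ι → S) : Function.Surjective (reesMap u) := by
  have key : reesAlgebra (Ideal.span (Set.range u)) ≤
      ((reesAlgebra (Ideal.span (Set.range u))).val.comp (reesMap u)).range := by
    refine (adjoin_monomial_eq_reesAlgebra (Ideal.span (Set.range u))).ge.trans ?_
    refine Algebra.adjoin_le ?_
    rintro _ ⟨r, hr, rfl⟩
    induction hr using Submodule.span_induction with
    | mem r hr =>
      obtain ⟨j, rfl⟩ := hr
      exact ⟨X j, by simp [reesMap, reesGen]⟩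
    | zero => rw [map_zero]; exact zero_mem _
    | add a b _ _ ha hb => rw [map_add]; exact add_mem ha hb
    | smul c a _ ha => rw [map_smul]; exact Subalgebra.smul_mem _ ha c
  intro r
  obtain ⟨p, hp⟩ := key r.2
  exact ⟨p, Subtype.ext hp⟩

/-- The defining ideal `J = Ker φ` of the Rees algebra. -/
def reesIdeal (u : ι → S) : Ideal (MvPolynomial ι S) :=
  RingHom.ker (reesMap u)

/-- The defining ideal `L` of the symmetric algebra of the ideal generated by the family `u`:
the ideal of `T` generated by the linear forms `∑_j a_j y_j`, where `a` runs through the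
relations (syzygies) of `u`, i.e. `∑_j a_j u_j = 0`. -/
def symIdeal [Fintype ι] (u : ι → S) : Ideal (MvPolynomial ι S) :=
  Ideal.span {l | ∃ a : ι → S, ∑ j, a j * u j = 0 ∧ l = ∑ j, C (a j) * X j}

/-- Linear type: `J = L`. -/
def IsLinearType [Fintype ι] (u : ι → S) : Prop :=
  reesIdeal u = symIdeal u

end Rees

section Fiber

variable {ι σ K : Type*} [Field K]

/-- The fiber cone `F(I) = R(I) / 𝔪 R(I)` of an ideal `I` of the polynomial ring
`S = K[x_i | i ∈ σ]`, where `𝔪` is the ideal generated by the variables. -/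
abbrev FiberCone (I : Ideal (MvPolynomial σ K)) : Type _ :=
  reesAlgebra I ⧸ (Ideal.span (Set.range (X : σ → MvPolynomial σ K))).map
    (algebraMap (MvPolynomial σ K) (reesAlgebra I))

/-- The natural map `φ' : K[y_j | j ∈ ι] → F(I)` sending `y_j` to the class of `u_j s`. -/
def fiberMap (u : ι → MvPolynomial σ K) :
    MvPolynomial ι K →ₐ[K] FiberCone (Ideal.span (Set.range u)) :=
  aeval fun j => Ideal.Quotient.mk _ (reesGen u j)

/-- The ideal `H = Ker φ'` of fiber relations. -/
def fiberIdeal (u : ι → MvPolynomial σ K) : Ideal (MvPolynomial ι K) :=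
  RingHom.ker (fiberMap u)

/-- The extension `H T` to `T = S[y_j | j ∈ ι]` of an ideal `H` of `K[y_j | j ∈ ι]`. -/
def extendToT (σ : Type*) (H : Ideal (MvPolynomial ι K)) :
    Ideal (MvPolynomial ι (MvPolynomial σ K)) :=
  H.map (MvPolynomial.map (C : K →+* MvPolynomial σ K))

/-- Fiber type: `J = L + H T`. -/
def IsFiberType [Fintype ι] (u : ι → MvPolynomial σ K) : Prop :=
  reesIdeal u = symIdeal u ⊔ extendToT σ (fiberIdeal u)

end Fiber

section Relations

variable (K : Type*) [Field K] (n : ℕ) [NeZero n]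

/-- The variable `x_j` of `S`, viewed in `T = S[y_j]`; the index is taken modulo `n`. -/
def xT (j : ℕ) : MvPolynomial (Fin n) (MvPolynomial (Fin n) K) :=
  C (X (Fin.ofNat n j))

/-- The variable `y_j` of `T = S[y_j]`; the index is taken modulo `n`. -/
def yT (j : ℕ) : MvPolynomial (Fin n) (MvPolynomial (Fin n) K) :=
  X (Fin.ofNat n j)

/-- `f_j = x_{n-2+j} y_j - x_j y_{j+1}`, for `2 ≤ n`. -/
def linRel (j : ℕ) : MvPolynomial (Fin n) (MvPolynomial (Fin n) K) :=
  xT K n (n - 2 + j) * yT K n j - xT K n j * yT K n (j + 1)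

/-- The ideal `(f_1, …, f_n)` of `T`. -/
def linRelIdeal : Ideal (MvPolynomial (Fin n) (MvPolynomial (Fin n) K)) :=
  Ideal.span (linRel K n '' Set.Icc 1 n)

/-- `h = ∏_{i=0}^{n/2-1} y_{2i} - ∏_{i=0}^{n/2-1} y_{2i+1}` in `K[y_j]`, for even `n`. -/
def fiberRel : MvPolynomial (Fin n) K :=
  ∏ i ∈ Finset.range (n / 2), X (Fin.ofNat n (2 * i)) -
    ∏ i ∈ Finset.range (n / 2), X (Fin.ofNat n (2 * i + 1))

end Relations

end

/-! The map `φ` sends monomials to monomials, so its kernel is spanned over `K` by differences of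
monomials `x^a y^b`, `x^c y^d` with equal image. The variables missing from `u_j` are `x_{j-1}` and
`x_{j-2}`; hence equal image means equal degree in `y` and `a v - c v = e (v+1) + e (v+2)`, where `e
= b - d`. Such monomials are shown to agree modulo the relations by induction on the degree in `y`:
rewrite one of them until both share factors in `y`, then strip these off. Take `p` with `|e p|`
maximal and, by symmetry, `e p > 0`. Unless both neighbours of `p` carry the value `-e p`, the
weights provide enough of `x_{p-1}`, `x_{p-2}` to move `y_p` by the linear relations to an index
occurring in `y^d` (`AgreeBelow.of_isMax`). If this fails at every maximal position, `e` alternates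
in sign around the whole cycle. For odd `n` this is impossible; for even `n` one alternating product
divides `y^b`, the other `y^d`, and `h` exchanges them (`AgreeBelow.of_alternating`). As `h` has
degree `n/2 > 1`, it plays no role in degree one, which gives `L`. Setting all `x_j` to zero in `J`
gives `H`. -/

/-! ### Rewriting monomials in a ring where the relations hold -/

section Exchange

variable {n : ℕ} {R : Type*} [CommRing R]

/-- The monomial `∏ i, x i ^ a i`. -/
def powProd (x : Fin n → R) (a : Fin n → ℕ) : R := ∏ i, x i ^ a i

theorem powProd_add (x : Fin n → R) (a b : Fin n → ℕ) :
    powProd x (a + b) = powProd x a * powProd x b := by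
  simp [powProd, pow_add, Finset.prod_mul_distrib]

theorem powProd_zero (x : Fin n → R) : powProd x 0 = 1 := by
  simp [powProd]

theorem powProd_single (x : Fin n → R) (i : Fin n) : powProd x (Pi.single i 1) = x i := by
  rw [powProd, Finset.prod_eq_single i] <;> simp +contextual

theorem exists_add_single {a : Fin n → ℕ} {i : Fin n} (h : 0 < a i) :
    ∃ a' : Fin n → ℕ, a = a' + Pi.single i 1 := by
  refine ⟨a - Pi.single i 1, funext fun j => ?_⟩
  by_cases hj : j = i
  · subst hj; simp; omega
  · simp [hj]

variable [NeZero n]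

/-- The weight of `x^a y^b`: up to the total degree in `y`, the exponent of its image under
`y_j ↦ u_j s`. -/
def wt (a b : Fin n → ℕ) (v : Fin n) : ℤ := a v - b (v + 1) - b (v + 1 + 1)

theorem wt_add (a b a' b' : Fin n → ℕ) : wt (a + a') (b + b') = wt a b + wt a' b' := by
  funext v; simp [wt]; ring

theorem add_one_eq_iff (v p : Fin n) : v + 1 = p ↔ v = p - 1 := eq_sub_iff_add_eq.symm

/-- Monomials of equal weight and equal degree less than `N` in `y` agree. -/
def AgreeBelow (x y : Fin n → R) (N : ℕ) : Prop :=
  ∀ a b c d : Fin n → ℕ, ∑ i, b i < N → ∑ i, b i = ∑ i, d i → wt a b = wt c d →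
    powProd x a * powProd y b = powProd x c * powProd y d

/-- Once `x^α y^β` is traded for `x^α' y^β'`, both sides contain `y^β'`. Only its exponents are
subtracted, the induction hypothesis is applied, and the factor is multiplied back, so no
cancellation in `R` is needed. -/
theorem AgreeBelow.exchange {x y : Fin n → R} {a₀ α α' b₀ β c d₀ β' : Fin n → ℕ}
    (ih : AgreeBelow x y (∑ i, (b₀ + β) i))
    (h : powProd x α * powProd y β = powProd x α' * powProd y β')
    (hw : wt α β = wt α' β') (hs : ∑ i, β i = ∑ i, β' i) (hpos : 0 < ∑ i, β i)
    (hsum : ∑ i, (b₀ + β) i = ∑ i, (d₀ + β') i)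
    (hwt : wt (a₀ + α) (b₀ + β) = wt c (d₀ + β')) :
    powProd x (a₀ + α) * powProd y (b₀ + β) = powProd x c * powProd y (d₀ + β') := by
  simp only [Pi.add_apply, Finset.sum_add_distrib] at hsum ih
  have h1 : wt (a₀ + α') b₀ = wt c d₀ := by
    have e1 : wt (a₀ + α') (b₀ + β') = wt (a₀ + α) (b₀ + β) := by rw [wt_add, wt_add, hw]
    rw [hwt] at e1
    have e2 := wt_add (a₀ + α') b₀ 0 β'
    have e3 := wt_add c d₀ 0 β'
    rw [add_zero] at e2 e3
    rw [e2, e3] at e1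
    exact add_right_cancel e1
  have h2 := ih (a₀ + α') b₀ c d₀ (by omega) (by omega) h1
  calc _ = powProd x a₀ * powProd y b₀ * (powProd x α * powProd y β) := by
        rw [powProd_add, powProd_add]; ring
    _ = powProd x (a₀ + α') * powProd y b₀ * powProd y β' := by rw [h, powProd_add]; ring
    _ = _ := by rw [h2, powProd_add]; ring

theorem wt_single_zero (i : Fin n) (v : Fin n) :
    wt (Pi.single i 1) 0 v = if v = i then 1 else 0 := by
  simp [wt, Pi.single_apply]

theorem wt_zero_single (i : Fin n) (v : Fin n) :
    wt 0 (Pi.single i 1) v = -(if v = i - 1 then 1 else 0) - (if v = i - 1 - 1 then 1 else 0) := by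
  simp [wt, Pi.single_apply, add_one_eq_iff]

theorem wt_eq_add (a b : Fin n → ℕ) : wt a b = wt a 0 + wt 0 b := by
  rw [← wt_add, add_zero, zero_add]

theorem wt_slide (p : Fin n) :
    wt (Pi.single (p - 1 - 1) 1) (Pi.single p 1) = wt (Pi.single p 1) (Pi.single (p + 1) 1) := by
  rw [wt_eq_add, wt_eq_add (Pi.single p 1)]
  funext v
  simp only [Pi.add_apply, wt_single_zero, wt_zero_single, add_sub_cancel_right]
  ring

theorem wt_block (p : Fin n) :
    wt (Pi.single (p - 1 - 1) 1 + Pi.single (p - 1) 1) (Pi.single p 1) = 0 := by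
  rw [wt_eq_add, ← add_zero (0 : Fin n → ℕ), wt_add, add_zero]
  funext v
  simp only [Pi.add_apply, wt_single_zero, wt_zero_single, Pi.zero_apply]
  ring

theorem Fin.induction_add_one {P : Fin n → Prop} (p : Fin n) (hp : P p)
    (h : ∀ j, P j → P (j + 1)) (q : Fin n) : P q := by
  have key : ∀ k : ℕ, P (p + Fin.ofNat n k) := by
    intro k
    induction k with
    | zero => simpa using hp
    | succ k ihk =>
      have : p + Fin.ofNat n (k + 1) = p + Fin.ofNat n k + 1 := by
        rw [add_assoc]; congr 1; ext; simp [Fin.val_add]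
      rw [this]; exact h _ ihk
  simpa using key (q - p).val

variable {x y : Fin n → R} (hf : ∀ j, x (j - 1 - 1) * y j = x j * y (j + 1))
include hf

/-- Multiplying the linear relation at `j` by `x (j - 1)` moves the block one step around the cycle.
In the Rees algebra each block becomes `x_1 ⋯ x_n s`. -/
theorem block_eq (p q : Fin n) :
    x (p - 1 - 1) * x (p - 1) * y p = x (q - 1 - 1) * x (q - 1) * y q := by
  refine Fin.induction_add_one
    (P := fun q => x (p - 1 - 1) * x (p - 1) * y p = x (q - 1 - 1) * x (q - 1) * y q)
    p rfl (fun j hj => hj.trans ?_) q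
  rw [add_sub_cancel_right]
  linear_combination x (j - 1) * hf j

theorem AgreeBelow.slide_right {a b c d : Fin n → ℕ} (ih : AgreeBelow x y (∑ i, b i))
    (hsum : ∑ i, b i = ∑ i, d i) (hwt : wt a b = wt c d) (p : Fin n)
    (ha : 0 < a (p - 1 - 1)) (hb : 0 < b p) (hd : 0 < d (p + 1)) :
    powProd x a * powProd y b = powProd x c * powProd y d := by
  obtain ⟨a, rfl⟩ := exists_add_single ha
  obtain ⟨b, rfl⟩ := exists_add_single hb
  obtain ⟨d, rfl⟩ := exists_add_single hd
  refine ih.exchange (α' := Pi.single p 1) ?_ (wt_slide p) ?_ ?_ hsum hwt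
  · simp only [powProd_single, hf]
  all_goals simp

theorem AgreeBelow.slide_left {a b c d : Fin n → ℕ} (ih : AgreeBelow x y (∑ i, b i))
    (hsum : ∑ i, b i = ∑ i, d i) (hwt : wt a b = wt c d) (p : Fin n)
    (ha : 0 < a p) (hb : 0 < b (p + 1)) (hd : 0 < d p) :
    powProd x a * powProd y b = powProd x c * powProd y d := by
  obtain ⟨a, rfl⟩ := exists_add_single ha
  obtain ⟨b, rfl⟩ := exists_add_single hb
  obtain ⟨d, rfl⟩ := exists_add_single hd
  refine ih.exchange (α' := Pi.single (p - 1 - 1) 1) ?_ (wt_slide p).symm ?_ ?_ hsum hwt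
  · simp only [powProd_single, hf]
  all_goals simp

/-- With both missing variables at hand, `y p` can move to any index, in particular to one that
occurs in `y^d`. -/
theorem AgreeBelow.jump {a b c d : Fin n → ℕ} (ih : AgreeBelow x y (∑ i, b i))
    (hsum : ∑ i, b i = ∑ i, d i) (hwt : wt a b = wt c d) (p q : Fin n)
    (ha : 0 < a (p - 1 - 1)) (ha' : 0 < a (p - 1)) (hne : p - 1 ≠ p - 1 - 1)
    (hb : 0 < b p) (hd : 0 < d q) :
    powProd x a * powProd y b = powProd x c * powProd y d := by
  obtain ⟨a, rfl⟩ := exists_add_single ha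
  obtain ⟨a, rfl⟩ := exists_add_single (a := a) (i := p - 1) (by simpa [hne] using ha')
  obtain ⟨b, rfl⟩ := exists_add_single hb
  obtain ⟨d, rfl⟩ := exists_add_single hd
  have e : a + Pi.single (p - 1) 1 + Pi.single (p - 1 - 1) 1 =
    a + (Pi.single (p - 1 - 1) 1 + Pi.single (p - 1) 1) := by abel
  rw [e] at hwt ⊢
  refine ih.exchange (α' := Pi.single (q - 1 - 1) 1 + Pi.single (q - 1) 1) ?_
    ((wt_block p).trans (wt_block q).symm) ?_ ?_ hsum hwt
  · simp only [powProd_add, powProd_single, block_eq hf p q]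
  all_goals simp

theorem AgreeBelow.of_isMax {a b c d : Fin n → ℕ} (hn : 3 ≤ n)
    (ih : AgreeBelow x y (∑ i, b i))
    (hsum : ∑ i, b i = ∑ i, d i) (hwt : wt a b = wt c d) (p : Fin n)
    (hpos : d p < b p) (hmax : ∀ j, |(b j : ℤ) - d j| ≤ b p - d p)
    (halt : ¬ ((b (p + 1) : ℤ) - d (p + 1) = -(b p - d p) ∧
      (b (p - 1) : ℤ) - d (p - 1) = -(b p - d p))) :
    powProd x a * powProd y b = powProd x c * powProd y d := by
  have g1 := congrFun hwt (p - 1)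
  have g2 := congrFun hwt (p - 1 - 1)
  simp only [wt, sub_add_cancel] at g1 g2
  have m1 := abs_le.mp (hmax (p + 1))
  have m2 := abs_le.mp (hmax (p - 1))
  by_cases c1 : b (p + 1) < d (p + 1) ∧ 0 < a (p - 1 - 1)
  · exact ih.slide_right hf hsum hwt p c1.2 (by omega) (by omega)
  by_cases c2 : b (p - 1) < d (p - 1) ∧ 0 < a (p - 1)
  · exact ih.slide_left hf hsum hwt (p - 1) c2.2 (by rw [sub_add_cancel]; omega) (by omega)
  obtain ⟨q, hq⟩ : ∃ q, 0 < d q := by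
    by_contra! h
    have : ∑ i, d i = 0 := Finset.sum_eq_zero fun i _ => Nat.le_zero.mp (h i)
    have := Finset.single_le_sum (f := b) (fun i _ => Nat.zero_le _) (Finset.mem_univ p)
    omega
  -- If `a` vanished at `p - 2`, maximality would force `e (p-1) = -e p`; failure of the left slide
  -- would then give `a (p-1) = 0` and `e (p+1) = -e p`, against `halt`. The same holds with the two
  -- sides exchanged, so both entries of `a` are positive.
  refine ih.jump hf hsum hwt p q (by omega) (by omega) ?_ (by omega) hq
  intro h
  have h1 : (1 : Fin n) = 0 := by simpa using h.symm
  have := congrArg Fin.val h1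
  rw [Fin.val_one', Fin.val_zero, Nat.mod_eq_of_lt (by omega)] at this
  omega

omit hf

/-- The exponent of the product of the `y_j` with `j` even (`r = 0`) or odd (`r = 1`). -/
def parityExp (n : ℕ) (r : ℕ) (j : Fin n) : ℕ := if j.val % 2 = r then 1 else 0

theorem sum_range_parity (m r : ℕ) (hr : r < 2) :
    ∑ i ∈ Finset.range (m + m), (if i % 2 = r then 1 else 0) = m := by
  induction m with
  | zero => simp
  | succ m ih =>
    rw [show m + 1 + (m + 1) = m + m + 1 + 1 by ring, Finset.sum_range_succ,
      Finset.sum_range_succ, ih]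
    split_ifs <;> omega

theorem prod_range_parity (g : ℕ → R) (m r : ℕ) (hr : r < 2) :
    ∏ i ∈ Finset.range (m + m), (g i) ^ (if i % 2 = r then 1 else 0) =
      ∏ i ∈ Finset.range m, g (2 * i + r) := by
  induction m with
  | zero => simp
  | succ m ih =>
    rw [show m + 1 + (m + 1) = m + m + 1 + 1 by ring, Finset.prod_range_succ,
      Finset.prod_range_succ, ih, Finset.prod_range_succ]
    interval_cases r
    · rw [if_pos (by omega), if_neg (by omega)]; simp [two_mul]
    · rw [if_neg (by omega), if_pos (by omega)]; simp [two_mul]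

omit [NeZero n] in
theorem sum_parityExp (hn : Even n) (r : ℕ) (hr : r < 2) : 2 * ∑ j, parityExp n r j = n := by
  obtain ⟨m, hm⟩ := hn
  have := Fin.sum_univ_eq_sum_range (fun i => if i % 2 = r then 1 else 0) n
  simp only [parityExp]
  rw [this, hm, sum_range_parity m r hr]; ring

theorem powProd_parityExp (hn : Even n) (y : Fin n → R) (r : ℕ) (hr : r < 2) :
    powProd y (parityExp n r) = ∏ i ∈ Finset.range (n / 2), y (Fin.ofNat n (2 * i + r)) := by
  obtain ⟨m, hm⟩ := hn
  have := Fin.prod_univ_eq_prod_range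
    (fun i => y (Fin.ofNat n i) ^ (if i % 2 = r then 1 else 0)) n
  simp only [Fin.ofNat_val_eq_self] at this
  simp only [powProd, parityExp]
  rw [this, show n / 2 = m by omega, ← prod_range_parity (fun i => y (Fin.ofNat n i)) m r hr]
  exact Finset.prod_congr (by rw [← hm]) fun _ _ => rfl

theorem val_add_one_mod_two (hn : Even n) (v : Fin n) : (v + 1).val % 2 = (v.val + 1) % 2 := by
  obtain ⟨m, hm⟩ := hn
  have hv := v.isLt
  rw [Fin.val_add, Fin.val_one', Nat.add_mod_mod]
  rcases Nat.lt_or_ge (v.val + 1) n with h | h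
  · rw [Nat.mod_eq_of_lt h]
  · rw [show v.val + 1 = n by omega, Nat.mod_self]; omega

theorem wt_parityExp (hn : Even n) (r : ℕ) (hr : r < 2) :
    wt 0 (parityExp n r) = fun _ => -1 := by
  funext v
  have h1 := val_add_one_mod_two hn v
  have h2 := val_add_one_mod_two hn (v + 1)
  simp only [wt, parityExp, Pi.zero_apply]
  split_ifs <;> push_cast <;> omega

theorem AgreeBelow.of_alternating {a b c d : Fin n → ℕ} (hn : Even n)
    (ih : AgreeBelow x y (∑ i, b i))
    (hsum : ∑ i, b i = ∑ i, d i) (hwt : wt a b = wt c d)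
    (hh : n ≤ 2 * ∑ i, b i →
      powProd y (parityExp n 0) = powProd y (parityExp n 1))
    (hpos : d 0 < b 0)
    (halt : ∀ p, (b (p + 1) : ℤ) - d (p + 1) = -(b p - d p)) :
    powProd x a * powProd y b = powProd x c * powProd y d := by
  have key : ∀ v : Fin n, (v.val % 2 = 0 → d v < b v) ∧ (v.val % 2 = 1 → b v < d v) := by
    refine Fin.induction_add_one 0 ⟨fun _ => hpos, by simp⟩ fun j hj => ?_
    have := halt j
    have := val_add_one_mod_two hn j
    omega
  obtain ⟨b', rfl⟩ : ∃ b', b = b' + parityExp n 0 := by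
    refine ⟨b - parityExp n 0, funext fun j => ?_⟩
    have := key j
    simp only [parityExp, Pi.add_apply, Pi.sub_apply]
    split_ifs <;> omega
  obtain ⟨d', rfl⟩ : ∃ d', d = d' + parityExp n 1 := by
    refine ⟨d - parityExp n 1, funext fun j => ?_⟩
    have := key j
    simp only [parityExp, Pi.add_apply, Pi.sub_apply]
    split_ifs <;> omega
  have s0 := sum_parityExp hn 0 (by omega)
  have s1 := sum_parityExp hn 1 (by omega)
  have hn0 := NeZero.ne n
  -- The fiber relation involves no `x`, so the exchanged exponents in `x` are zero on both sides.
  rw [← add_zero a] at hwt ⊢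
  refine ih.exchange (α' := 0) ?_ ?_ (by omega) (by omega) hsum hwt
  · rw [hh]
    simp only [Pi.add_apply, Finset.sum_add_distrib]
    omega
  · rw [wt_parityExp hn 0 (by omega), wt_parityExp hn 1 (by omega)]

/-- Monomials of equal weight and equal degree in `y` agree, as soon as the linear relations
hold and, for even `n` and large degree, the fiber relation holds. -/
theorem powProd_mul_powProd_eq (hn : 3 ≤ n)
    (hf : ∀ j, x (j - 1 - 1) * y j = x j * y (j + 1)) (N : ℕ)
    (hh : Even n → n ≤ 2 * N → powProd y (parityExp n 0) = powProd y (parityExp n 1))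
    {a b c d : Fin n → ℕ} (hb : ∑ i, b i = N) (hd : ∑ i, d i = N) (hwt : wt a b = wt c d) :
    powProd x a * powProd y b = powProd x c * powProd y d := by
  induction N using Nat.strong_induction_on generalizing a b c d with
  | _ N ih =>
  have ihb : AgreeBelow x y (∑ i, b i) := fun a' b' c' d' hlt hs hw =>
    ih _ (hb ▸ hlt) (fun he hle => hh he (by omega)) rfl hs.symm hw
  have ihd : AgreeBelow x y (∑ i, d i) := by rwa [hd, ← hb]
  have hsum := hb.trans hd.symm
  obtain ⟨p, -, hp⟩ := Finset.exists_max_image (Finset.univ : Finset (Fin n))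
    (fun j => |(b j : ℤ) - d j|) Finset.univ_nonempty
  replace hp := fun j => hp j (Finset.mem_univ j)
  by_cases h0 : (b p : ℤ) - d p = 0
  · have hbd : b = d := by
      funext j
      have := hp j
      rw [h0, abs_zero, abs_nonpos_iff] at this
      omega
    subst hbd
    have hac : a = c := by
      funext v
      have := congrFun hwt v
      simp only [wt] at this
      omega
    rw [hac]
  by_cases hex : ∃ q, |(b q : ℤ) - d q| = |(b p : ℤ) - d p| ∧
      ¬ ((b (q + 1) : ℤ) - d (q + 1) = -(b q - d q) ∧
        (b (q - 1) : ℤ) - d (q - 1) = -(b q - d q))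
  · obtain ⟨q, hq, halt⟩ := hex
    -- The sign at the extremal position is not prescribed; if negative, the two monomials change
    -- roles.
    rcases lt_trichotomy (b q) (d q) with hlt | heq | hlt
    · refine (ihd.of_isMax hf hn hsum.symm hwt.symm q hlt (fun j => ?_) ?_).symm
      · rw [abs_sub_comm]
        refine (hp j).trans (hq.symm.le.trans (le_of_eq ?_))
        rw [abs_of_neg (by omega)]; ring
      · omega
    · rw [heq, sub_self, abs_zero, eq_comm, abs_eq_zero] at hq
      exact absurd hq h0
    · refine ihb.of_isMax hf hn hsum hwt q hlt (fun j => ?_) halt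
      refine (hp j).trans (hq.symm.le.trans (le_of_eq ?_))
      rw [abs_of_pos (by omega)]
  push Not at hex
  have hall : ∀ q, |(b q : ℤ) - d q| = |(b p : ℤ) - d p| := by
    refine Fin.induction_add_one p rfl fun j hj => ?_
    rw [(hex j hj).1, abs_neg, hj]
  have halt := fun q => (hex q (hall q)).1
  have h00 : b 0 ≠ d 0 := by
    intro h
    have := hall 0
    rw [h, sub_self, abs_zero, eq_comm, abs_eq_zero] at this
    exact h0 this
  rcases Nat.even_or_odd n with he | ho
  · rcases lt_or_gt_of_ne h00 with hlt | hlt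
    · exact (ihd.of_alternating he hsum.symm hwt.symm (fun h => hh he (hd ▸ h)) hlt
        fun q => by have := halt q; omega).symm
    · exact ihb.of_alternating he hsum hwt (fun h => hh he (hb ▸ h)) hlt halt
  · exfalso
    -- Going once around an odd cycle returns to index `0` with the opposite sign.
    have key : ∀ k : ℕ, (b (Fin.ofNat n k) : ℤ) - d (Fin.ofNat n k) = (-1) ^ k * (b 0 - d 0) := by
      intro k
      induction k with
      | zero => simp
      | succ k ihk =>
        have : Fin.ofNat n (k + 1) = Fin.ofNat n k + 1 := by ext; simp [Fin.val_add]
        rw [this, halt, ihk, pow_succ]; ring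
    have := key n
    rw [ho.neg_one_pow, show Fin.ofNat n n = 0 by ext; simp] at this
    omega

end Exchange

/-! ### Kernels of monomial maps -/

section MonomialKernel

/-- The kernel of a map sending the `M i` to basis vectors consists, on the span of the `M i`, of
combinations of differences `M i - M j` with equal images. -/
theorem mem_of_map_eq_zero {K V W ι κ : Type*} [Ring K] [AddCommGroup V] [Module K V]
    [AddCommGroup W] [Module K W] (B : Module.Basis κ K W) (φ : V →ₗ[K] W) (M : ι → V) (w : ι → κ)
    (hφ : ∀ i, φ (M i) = B (w i)) (Q : Submodule K V)
    (hQ : ∀ i j, w i = w j → M i - M j ∈ Q) {p : V} (hp : p ∈ Submodule.span K (Set.range M))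
    (h0 : φ p = 0) : p ∈ Q := by
  classical
  -- Each basis vector goes to the class of a chosen preimage; by `hQ` the choice does not matter,
  -- so `ψ ∘ φ` is the quotient map on the span.
  let ψ : W →ₗ[K] V ⧸ Q := B.constr ℕ fun k =>
    if h : ∃ i, w i = k then Q.mkQ (M h.choose) else 0
  have key : ψ (φ p) = Q.mkQ p := by
    clear h0
    induction hp using Submodule.span_induction with
    | mem p hp =>
      obtain ⟨i, rfl⟩ := hp
      have hi : ∃ j, w j = w i := ⟨i, rfl⟩
      rw [hφ, Module.Basis.constr_basis, dif_pos hi]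
      exact (Submodule.Quotient.eq Q).mpr (hQ _ _ hi.choose_spec)
    | zero => simp
    | add p q _ _ hp hq => rw [map_add, map_add, map_add, hp, hq]
    | smul c p _ hp => rw [map_smul, map_smul, map_smul, hp]
  rw [h0, map_zero] at key
  exact (Submodule.Quotient.mk_eq_zero Q).mp key.symm

variable {K : Type*} [Field K] {n : ℕ}

/-- The monomial `x^a y^b` of `T`. -/
noncomputable def biMonomial (K : Type*) [Field K] (m : (Fin n →₀ ℕ) × (Fin n →₀ ℕ)) :
    MvPolynomial (Fin n) (MvPolynomial (Fin n) K) :=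
  monomial m.2 (monomial m.1 1)

theorem map_biMonomial {R : Type*} [CommRing R]
    (ψ : MvPolynomial (Fin n) (MvPolynomial (Fin n) K) →+* R)
    (m : (Fin n →₀ ℕ) × (Fin n →₀ ℕ)) :
    ψ (biMonomial K m) =
      powProd (fun i => ψ (C (X i))) m.1 * powProd (fun i => ψ (X i)) m.2 := by
  simp [biMonomial, monomial_eq (s := m.2), monomial_eq (s := m.1), powProd, Finsupp.prod_fintype]

theorem span_biMonomial :
    Submodule.span K (Set.range (biMonomial (n := n) K)) = ⊤ := by
  rw [← ((basisMonomials (Fin n) K).smulTower (basisMonomials (Fin n)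
    (MvPolynomial (Fin n) K))).span_eq]
  congr 2
  funext m
  simp [biMonomial, smul_monomial]

/-- The monomial basis of `S[s]`. -/
noncomputable def reesBasis (n : ℕ) (K : Type*) [Field K] :
    Module.Basis ((Fin n →₀ ℕ) × ℕ) K (Polynomial (MvPolynomial (Fin n) K)) :=
  (basisMonomials (Fin n) K).smulTower (Polynomial.basisMonomials (MvPolynomial (Fin n) K))

theorem reesBasis_apply (m : (Fin n →₀ ℕ) × ℕ) :
    reesBasis n K m = Polynomial.monomial m.2 (monomial m.1 1) := by
  simp [reesBasis, Polynomial.smul_monomial]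

theorem prod_monomial_monomial {ι : Type*} (s : Finset ι) (f : ι → ℕ) (g : ι → Fin n →₀ ℕ) :
    ∏ i ∈ s, Polynomial.monomial (f i) (monomial (g i) (1 : K)) =
      Polynomial.monomial (∑ i ∈ s, f i) (monomial (∑ i ∈ s, g i) 1) := by
  classical
  induction s using Finset.induction_on with
  | empty => simp
  | insert i s hi ih =>
    rw [Finset.prod_insert hi, Finset.sum_insert hi, Finset.sum_insert hi, ih,
      Polynomial.monomial_mul_monomial, monomial_mul, one_mul]

theorem val_reesMap (u : Fin n → MvPolynomial (Fin n) K)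
    (p : MvPolynomial (Fin n) (MvPolynomial (Fin n) K)) :
    (reesMap u p : Polynomial (MvPolynomial (Fin n) K)) =
      aeval (fun j => Polynomial.monomial 1 (u j)) p := by
  have : (reesAlgebra (Ideal.span (Set.range u))).val.comp (reesMap u) =
      aeval (fun j => Polynomial.monomial 1 (u j)) := by
    ext j : 1
    simp [reesMap, reesGen]
  exact DFunLike.congr_fun this p

theorem mem_reesIdeal_iff (u : Fin n → MvPolynomial (Fin n) K)
    (p : MvPolynomial (Fin n) (MvPolynomial (Fin n) K)) :
    p ∈ reesIdeal u ↔ aeval (fun j => Polynomial.monomial 1 (u j)) p = 0 := by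
  rw [← val_reesMap, ZeroMemClass.coe_eq_zero]; rfl

theorem aeval_biMonomial (ε : Fin n → Fin n →₀ ℕ) (m : (Fin n →₀ ℕ) × (Fin n →₀ ℕ)) :
    aeval (fun j => Polynomial.monomial 1 (monomial (ε j) (1 : K))) (biMonomial K m) =
      reesBasis n K (m.1 + ∑ j, m.2 j • ε j, ∑ j, m.2 j) := by
  rw [reesBasis_apply, biMonomial, aeval_monomial, Finsupp.prod_fintype _ _ (by simp),
    Polynomial.algebraMap_eq, ← Polynomial.monomial_zero_left]
  simp only [Polynomial.monomial_pow, monomial_pow, one_pow, one_mul]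
  rw [prod_monomial_monomial, Polynomial.monomial_mul_monomial, monomial_mul, one_mul, zero_add]

end MonomialKernel

/-! ### Exponents of the path monomials and the binomials in `J` -/

section Cycle

variable {K : Type*} [Field K] {n : ℕ} [NeZero n]

theorem ofNat_val_add_one (j : ℕ) : Fin.ofNat n (j + 1) = Fin.ofNat n j + 1 := by
  ext; simp [Fin.val_add]

theorem ofNat_val_add (j : Fin n) (k : ℕ) : Fin.ofNat n (j.val + k) = j + Fin.ofNat n k := by
  ext; simp [Fin.val_add]

theorem add_ofNat_sub_two (hn : 2 ≤ n) (j : Fin n) : j + Fin.ofNat n (n - 2) = j - 1 - 1 := by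
  have h : Fin.ofNat n (n - 2) + 1 + 1 = 0 := by
    rw [← ofNat_val_add_one, ← ofNat_val_add_one, show n - 2 + 1 + 1 = n by omega]
    ext; simp
  rw [← sub_eq_zero, ← h]; abel

/-- The exponent of the monomial `u_j`. -/
noncomputable def cyclePathExp (n : ℕ) [NeZero n] (t : ℕ) (j : Fin n) : Fin n →₀ ℕ :=
  ∑ k ∈ Finset.range t, Finsupp.single (Fin.ofNat n (j.val + k)) 1

theorem cyclePathMonomial_eq (t : ℕ) :
    cyclePathMonomial K n t = fun j => monomial (cyclePathExp n t j) 1 := by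
  funext j
  rw [cyclePathMonomial, cyclePathExp, monomial_sum_one]
  rfl

/-- Adding the two missing variables to `u_j` completes a window of `n` consecutive indices, which
meets `v` exactly once. -/
theorem cyclePathExp_add (hn : 2 ≤ n) (j v : Fin n) :
    cyclePathExp n (n - 2) j v + (if j = v + 1 then 1 else 0) +
      (if j = v + 1 + 1 then 1 else 0) = 1 := by
  have h : ∑ k ∈ Finset.range (n - 2 + 1 + 1),
      Finsupp.single (Fin.ofNat n (j.val + k)) 1 v = 1 := by
    rw [show n - 2 + 1 + 1 = n by omega]
    rw [← Fin.sum_univ_eq_sum_range (fun k => Finsupp.single (Fin.ofNat n (j.val + k)) 1 v) n]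
    simp only [ofNat_val_add, Fin.ofNat_val_eq_self]
    rw [Fintype.sum_eq_single (v - j)]
    · simp
    · intro k hk
      exact Finsupp.single_eq_of_ne fun h => hk (by rw [h]; abel)
  rw [Finset.sum_range_succ, Finset.sum_range_succ] at h
  rw [← Nat.add_assoc, ofNat_val_add_one, ofNat_val_add j (n - 2), add_ofNat_sub_two hn,
    sub_add_cancel] at h
  rw [cyclePathExp, Finsupp.finsetSum_apply]
  refine Eq.trans ?_ h
  rw [add_right_comm]
  simp only [Finsupp.single_apply, sub_eq_iff_eq_add]

theorem cyclePathExp_sum (hn : 2 ≤ n) (b : Fin n →₀ ℕ) (v : Fin n) :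
    (∑ j, b j • cyclePathExp n (n - 2) j) v + b (v + 1) + b (v + 1 + 1) = ∑ j, b j := by
  have : ∀ j, b j = b j * cyclePathExp n (n - 2) j v + (if j = v + 1 then b j else 0) +
      (if j = v + 1 + 1 then b j else 0) := fun j => by
    conv_lhs => rw [← mul_one (b j), ← cyclePathExp_add hn j v]
    simp [mul_add]
  rw [Finset.sum_congr rfl fun j _ => this j]
  simp [Finset.sum_add_distrib]

theorem wt_eq_of_image_eq (hn : 2 ≤ n) {a b c d : Fin n →₀ ℕ} (hs : ∑ j, b j = ∑ j, d j)
    (h : a + ∑ j, b j • cyclePathExp n (n - 2) j = c + ∑ j, d j • cyclePathExp n (n - 2) j) :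
    wt a b = wt c d := by
  funext v
  have h1 := cyclePathExp_sum hn b v
  have h2 := cyclePathExp_sum hn d v
  have h3 := DFunLike.congr_fun h v
  rw [Finsupp.add_apply, Finsupp.add_apply] at h3
  simp only [wt]
  omega

theorem linRel_eq (hn : 2 ≤ n) (j : ℕ) :
    linRel K n j = C (X (Fin.ofNat n j - 1 - 1)) * X (Fin.ofNat n j) -
      C (X (Fin.ofNat n j)) * X (Fin.ofNat n j + 1) := by
  have : Fin.ofNat n (n - 2 + j) = Fin.ofNat n j + Fin.ofNat n (n - 2) := by
    ext; simp [Fin.val_add, add_comm]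
  rw [linRel, xT, xT, yT, yT, ofNat_val_add_one, this, add_ofNat_sub_two hn]

theorem exists_ofNat_eq (j : Fin n) : ∃ k ∈ Set.Icc 1 n, Fin.ofNat n k = j := by
  rcases Nat.eq_zero_or_pos j.val with h | h
  · exact ⟨n, ⟨NeZero.one_le, le_rfl⟩, by ext; simp [h]⟩
  · exact ⟨j.val, ⟨h, j.isLt.le⟩, by simp⟩

theorem linRel_mem (hn : 2 ≤ n) (j : Fin n) :
    C (X (j - 1 - 1)) * X j - C (X j) * X (j + 1) ∈ linRelIdeal K n := by
  obtain ⟨k, hk, rfl⟩ := exists_ofNat_eq j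
  rw [← linRel_eq hn]
  exact Ideal.subset_span ⟨k, hk, rfl⟩

/-- The kernel of `φ` is generated by binomials, so an ideal that contains the linear relations
contains all elements of the kernel whose degrees in `y` it controls. -/
theorem mem_of_mem_reesIdeal (hn : 3 ≤ n)
    (Q : Ideal (MvPolynomial (Fin n) (MvPolynomial (Fin n) K))) (hL : linRelIdeal K n ≤ Q)
    (D : Set ℕ) (hD : ∀ N ∈ D, Even n → n ≤ 2 * N →
      MvPolynomial.map (C : K →+* MvPolynomial (Fin n) K) (fiberRel K n) ∈ Q)
    {p : MvPolynomial (Fin n) (MvPolynomial (Fin n) K)}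
    (hp : p ∈ Submodule.span K (biMonomial K '' {m | ∑ j, m.2 j ∈ D}))
    (h0 : p ∈ reesIdeal (cyclePathMonomial K n (n - 2))) : p ∈ Q := by
  rw [mem_reesIdeal_iff, cyclePathMonomial_eq] at h0
  rw [Set.image_eq_range] at hp
  refine mem_of_map_eq_zero (reesBasis n K)
    ((aeval fun j => Polynomial.monomial 1
      (monomial (cyclePathExp n (n - 2) j) (1 : K))).toLinearMap.restrictScalars K)
    _ _ (fun m => aeval_biMonomial _ _) (Q.restrictScalars K) ?_ hp h0
  rintro ⟨⟨a, b⟩, hb⟩ ⟨⟨c, d⟩, hd⟩ h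
  obtain ⟨h1, h2⟩ := Prod.ext_iff.mp h
  simp only at h1 h2
  change biMonomial K (a, b) - biMonomial K (c, d) ∈ Q
  rw [← Ideal.Quotient.eq]
  refine (map_biMonomial (K := K) (R := _ ⧸ Q) (Ideal.Quotient.mk Q) (a, b)).trans <| Eq.trans ?_
    (map_biMonomial (K := K) (R := _ ⧸ Q) (Ideal.Quotient.mk Q) (c, d)).symm
  -- The exchange argument runs in the quotient by `Q`, on the classes of the variables.
  refine powProd_mul_powProd_eq hn (fun j => ?_) _ (fun he hle => ?_) rfl h2.symm
    (wt_eq_of_image_eq (by omega) h2 h1)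
  · rw [← map_mul, ← map_mul, Ideal.Quotient.eq]
    exact hL (linRel_mem (by omega) j)
  · rw [powProd_parityExp he _ _ (by omega), powProd_parityExp he _ _ (by omega), ← map_prod,
      ← map_prod, Ideal.Quotient.eq]
    simpa [fiberRel] using hD _ hb he hle

end Cycle

/-! ### Paths of the cycle are arcs -/

section CyclePaths

open SimpleGraph

variable {n : ℕ} [NeZero n]

/-- The list `j, j + 1, …, j + l - 1` of consecutive vertices of the cycle. -/
def arc (j : Fin n) (l : ℕ) : List (Fin n) := (List.range l).map fun k => j + Fin.ofNat n k

theorem arc_succ (j : Fin n) (l : ℕ) : arc j (l + 1) = j :: arc (j + 1) l := by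
  rw [arc, arc, List.range_succ_eq_map, List.map_cons, List.map_map]
  congr 1
  · simp
  · refine List.map_congr_left fun k _ => ?_
    simp only [Function.comp_apply, Nat.succ_eq_add_one, ofNat_val_add_one]
    abel

theorem arc_succ' (j : Fin n) (l : ℕ) : arc j (l + 1) = arc j l ++ [j + Fin.ofNat n l] := by
  simp [arc, List.range_succ]

theorem arc_one (j : Fin n) : arc j 1 = [j] := by
  simp [arc]

theorem length_arc (j : Fin n) (l : ℕ) : (arc j l).length = l := by
  simp [arc]

theorem nodup_arc (j : Fin n) {l : ℕ} (hl : l ≤ n) : (arc j l).Nodup := by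
  refine List.Nodup.map_on (fun a ha b hb h => ?_) List.nodup_range
  have := congrArg Fin.val (add_left_cancel h)
  rw [List.mem_range] at ha hb
  rwa [Fin.val_ofNat, Fin.val_ofNat, Nat.mod_eq_of_lt (by omega), Nat.mod_eq_of_lt (by omega)]
    at this

theorem cycleGraph_adj_iff (hn : 2 ≤ n) (u v : Fin n) :
    (cycleGraph n).Adj u v ↔ v = u + 1 ∨ u = v + 1 := by
  have h1 : ∀ w : Fin n, w.val = 1 ↔ w = 1 := fun w => by
    rw [Fin.ext_iff, Fin.val_one', Nat.mod_eq_of_lt (by omega)]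
  rw [cycleGraph_adj', h1, h1, sub_eq_iff_eq_add, sub_eq_iff_eq_add, or_comm,
    add_comm 1, add_comm 1]

/-- A path in the cycle cannot turn back, so it keeps running upwards or downwards. The equation for
`v` lets the downward case be extended at its start. -/
theorem support_eq_arc (hn : 2 ≤ n) {v w : Fin n} (p : (cycleGraph n).Walk v w) (hp : p.IsPath) :
    (∃ l, p.support = arc v (l + 1)) ∨
      ∃ l, p.support.reverse = arc w (l + 1) ∧ v = w + Fin.ofNat n l := by
  induction p with
  | nil => exact Or.inl ⟨0, by simp [arc_one]⟩
  | @cons u v w h p ih =>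
    rw [Walk.cons_isPath_iff] at hp
    rw [cycleGraph_adj_iff hn] at h
    rw [Walk.support_cons, List.reverse_cons]
    rcases ih hp.1 with ⟨l, hl⟩ | ⟨l, hl, hv⟩
    · rcases h with rfl | rfl
      · exact Or.inl ⟨l + 1, by rw [hl, ← arc_succ]⟩
      -- A one-vertex path has no direction yet and may be extended either way; a longer one already
      -- contains `u`.
      · cases l with
        | zero =>
          have hw := p.end_mem_support
          rw [hl, arc_one, List.mem_singleton] at hw
          subst hw
          exact Or.inr ⟨1, by rw [hl, arc_succ w 1, zero_add, arc_one, arc_one]; rfl, rfl⟩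
        | succ l => exact absurd (by rw [hl, arc_succ, arc_succ]; simp) hp.2
    · rcases h with rfl | rfl
      · cases l with
        | zero =>
          rw [arc_one, List.reverse_eq_iff] at hl
          have : u + 1 = w := by simpa using hv
          exact Or.inl ⟨1, by rw [hl, arc_succ, arc_one, this]; simp⟩
        | succ l =>
          rw [ofNat_val_add_one, ← add_assoc] at hv
          refine absurd ?_ hp.2
          rw [← List.mem_reverse, hl, arc_succ', arc_succ', add_right_cancel hv]
          simp
      · have : v + 1 = w + Fin.ofNat n (l + 1) := by rw [hv, ofNat_val_add_one, add_assoc]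
        exact Or.inr ⟨l + 1, by rw [hl, arc_succ' w (l + 1), this], this⟩

theorem exists_walk_support_eq_arc (hn : 2 ≤ n) (l : ℕ) (j : Fin n) :
    ∃ w, ∃ p : (cycleGraph n).Walk j w, p.support = arc j (l + 1) := by
  induction l generalizing j with
  | zero => exact ⟨j, Walk.nil, by simp [arc_one]⟩
  | succ l ih =>
    obtain ⟨w, p, hp⟩ := ih (j + 1)
    refine ⟨w, Walk.cons ((cycleGraph_adj_iff hn _ _).mpr (Or.inl rfl)) p, ?_⟩
    rw [Walk.support_cons, hp, ← arc_succ]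

theorem prod_arc (K : Type*) [Field K] (j : Fin n) (t : ℕ) :
    ((arc j t).map (X : Fin n → MvPolynomial (Fin n) K)).prod = cyclePathMonomial K n t j := by
  rw [cyclePathMonomial, Finset.prod_range, arc, List.map_map, ← List.prod_ofFn, List.ofFn_eq_map,
    ← List.map_coe_finRange_eq_range, List.map_map]
  simp only [ofNat_val_add]
  rfl

theorem span_cyclePathMonomial (K : Type*) [Field K] (hn : 3 ≤ n) :
    Ideal.span (Set.range (cyclePathMonomial K n (n - 2))) =
      pathIdeal K (cycleGraph n) (n - 2) := by
  refine congrArg Ideal.span (Set.ext fun m => ⟨?_, ?_⟩)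
  · rintro ⟨j, rfl⟩
    obtain ⟨w, p, hp⟩ := exists_walk_support_eq_arc (by omega) (n - 2 - 1) j
    rw [show n - 2 - 1 + 1 = n - 2 by omega] at hp
    exact ⟨j, w, p, (Walk.isPath_def _).mpr (hp ▸ nodup_arc j (by omega)),
      by rw [hp, length_arc], by rw [hp, prod_arc]⟩
  · rintro ⟨v, w, p, hp, hlen, rfl⟩
    rcases support_eq_arc (by omega) p hp with ⟨l, hl⟩ | ⟨l, hl, -⟩
    · rw [hl, length_arc] at hlen
      exact ⟨v, by rw [hl, hlen, prod_arc]⟩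
    · rw [← List.length_reverse, hl, length_arc] at hlen
      exact ⟨w, by rw [← List.prod_reverse, ← List.map_reverse, hl, hlen, prod_arc]⟩

end CyclePaths

/-! ### The ideals `L` and `J` -/

section Relations

variable {K : Type*} [Field K] {n : ℕ} [NeZero n]

theorem X_mul_cyclePathMonomial (hn : 2 ≤ n) (j : Fin n) :
    X (j - 1 - 1) * cyclePathMonomial K n (n - 2) j =
      X j * cyclePathMonomial K n (n - 2) (j + 1) := by
  have h := (Finset.prod_range_succ' (fun k => (X (j + Fin.ofNat n k) : MvPolynomial (Fin n) K))
    (n - 2)).symm.trans (Finset.prod_range_succ _ _)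
  have e : ∀ k, j + Fin.ofNat n (k + 1) = j + 1 + Fin.ofNat n k := fun k => by
    rw [ofNat_val_add_one]; abel
  simp only [cyclePathMonomial, ofNat_val_add]
  rw [add_ofNat_sub_two hn] at h
  simp only [e] at h
  rw [mul_comm, ← h, mul_comm]
  simp

theorem linRelIdeal_le_symIdeal (hn : 2 ≤ n) :
    linRelIdeal K n ≤ symIdeal (cyclePathMonomial K n (n - 2)) := by
  rw [linRelIdeal, Ideal.span_le]
  rintro _ ⟨k, -, rfl⟩
  rw [linRel_eq hn]
  generalize Fin.ofNat n k = j
  refine Ideal.subset_span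
    ⟨Pi.single j (X (j - 1 - 1)) - Pi.single (j + 1) (X j), ?_, ?_⟩
  · simp [sub_mul, Pi.single_apply, X_mul_cyclePathMonomial hn]
  · simp [sub_mul, Pi.single_apply, apply_ite C]

omit [NeZero n] in
theorem symIdeal_le_reesIdeal (u : Fin n → MvPolynomial (Fin n) K) :
    symIdeal u ≤ reesIdeal u := by
  rw [symIdeal, Ideal.span_le]
  rintro _ ⟨a, ha, rfl⟩
  rw [SetLike.mem_coe, mem_reesIdeal_iff]
  simp only [map_sum, map_mul, aeval_C, aeval_X, Polynomial.algebraMap_eq,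
    Polynomial.C_mul_monomial]
  rw [← map_sum, ha, map_zero]

/-- The generators of `L` are elements of `J` linear in `y`, and in degree one the binomial argument
uses no fiber relation because `n > 2`. -/
theorem symIdeal_eq (hn : 3 ≤ n) :
    symIdeal (cyclePathMonomial K n (n - 2)) = linRelIdeal K n := by
  refine le_antisymm ?_ (linRelIdeal_le_symIdeal (by omega))
  rw [symIdeal, Ideal.span_le]
  rintro l ⟨a, ha, rfl⟩
  refine mem_of_mem_reesIdeal hn _ le_rfl {1} (by rintro N rfl; omega) ?_
    (symIdeal_le_reesIdeal _ (Ideal.subset_span ⟨a, ha, rfl⟩))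
  refine sum_mem fun j _ => ?_
  rw [(a j).as_sum, map_sum, Finset.sum_mul]
  refine sum_mem fun m _ => ?_
  have : C (monomial m (coeff m (a j))) * X j =
      coeff m (a j) • biMonomial K (m, Finsupp.single j 1) := by
    rw [biMonomial, C_mul_X_eq_monomial, smul_monomial, smul_monomial, smul_eq_mul, mul_one]
  rw [this]
  exact Submodule.smul_mem _ _ (Submodule.subset_span ⟨_, by simp [Finsupp.single_apply], rfl⟩)

theorem map_fiberRel (he : Even n) :
    MvPolynomial.map (C : K →+* MvPolynomial (Fin n) K) (fiberRel K n) =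
      biMonomial K (0, Finsupp.equivFunOnFinite.symm (parityExp n 0)) -
        biMonomial K (0, Finsupp.equivFunOnFinite.symm (parityExp n 1)) := by
  have h := map_biMonomial (RingHom.id (MvPolynomial (Fin n) (MvPolynomial (Fin n) K)))
  simp only [RingHom.id_apply] at h
  rw [h, h]
  simp [powProd_parityExp he, powProd_zero, fiberRel]

/-- Among any two cyclically consecutive indices exactly one is even, so both products in `h` have
weight `-1` everywhere; both also have degree `n/2`. -/
theorem map_fiberRel_mem_reesIdeal (hn : 2 ≤ n) (he : Even n) :
    MvPolynomial.map (C : K →+* MvPolynomial (Fin n) K) (fiberRel K n) ∈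
      reesIdeal (cyclePathMonomial K n (n - 2)) := by
  rw [mem_reesIdeal_iff, cyclePathMonomial_eq, map_fiberRel he, map_sub, aeval_biMonomial,
    aeval_biMonomial, sub_eq_zero]
  have h0 := sum_parityExp he 0 (by omega)
  have h1 := sum_parityExp he 1 (by omega)
  congr 2
  · ext v
    have e0 := cyclePathExp_sum hn (Finsupp.equivFunOnFinite.symm (parityExp n 0)) v
    have e1 := cyclePathExp_sum hn (Finsupp.equivFunOnFinite.symm (parityExp n 1)) v
    have w0 := congrFun (wt_parityExp he 0 (by omega)) v
    have w1 := congrFun (wt_parityExp he 1 (by omega)) v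
    simp only [wt, Pi.zero_apply] at w0 w1
    simp only [Finsupp.equivFunOnFinite_symm_apply_apply, zero_add] at e0 e1 ⊢
    omega
  · simp only [Finsupp.equivFunOnFinite_symm_apply_apply]
    omega

theorem reesIdeal_eq_of_odd (hn : 3 ≤ n) (ho : Odd n) :
    reesIdeal (cyclePathMonomial K n (n - 2)) = linRelIdeal K n := by
  refine le_antisymm (fun p hp => ?_) ((symIdeal_eq hn).symm.le.trans (symIdeal_le_reesIdeal _))
  refine mem_of_mem_reesIdeal hn _ le_rfl Set.univ
    (fun _ _ he => absurd he (Nat.not_even_iff_odd.mpr ho)) ?_ hp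
  simp [span_biMonomial]

omit [NeZero n] in
theorem extendToT_span_singleton (h : MvPolynomial (Fin n) K) :
    extendToT (Fin n) (Ideal.span {h}) =
      Ideal.span {MvPolynomial.map (C : K →+* MvPolynomial (Fin n) K) h} := by
  rw [extendToT, Ideal.map_span, Set.image_singleton]

theorem reesIdeal_eq_of_even (hn : 3 ≤ n) (he : Even n) :
    reesIdeal (cyclePathMonomial K n (n - 2)) =
      linRelIdeal K n ⊔ extendToT (Fin n) (Ideal.span {fiberRel K n}) := by
  rw [extendToT_span_singleton]
  refine le_antisymm (fun p hp => ?_) (sup_le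
    ((symIdeal_eq hn).symm.le.trans (symIdeal_le_reesIdeal _)) ?_)
  · refine mem_of_mem_reesIdeal hn _ le_sup_left Set.univ
      (fun _ _ _ _ => Ideal.mem_sup_right (Ideal.mem_span_singleton_self _)) ?_ hp
    simp [span_biMonomial]
  · rw [Ideal.span_singleton_le_iff_mem]
    exact map_fiberRel_mem_reesIdeal (by omega) he

end Relations

/-! ### The fiber relations -/

section FiberRelations

variable {ι σ K : Type*} [Field K]

theorem fiberMap_eq (u : ι → MvPolynomial σ K) (p : MvPolynomial ι K) :
    fiberMap u p =
      Ideal.Quotient.mk _ (reesMap u (MvPolynomial.map (C : K →+* MvPolynomial σ K) p)) := by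
  induction p using MvPolynomial.induction_on with
  | C c =>
    rw [fiberMap, aeval_C, map_C, reesMap, aeval_C]
    rfl
  | add p q hp hq => simp only [map_add, hp, hq]
  | mul_X p j hp => rw [map_mul, hp]; simp [fiberMap, reesMap]

/-- A fiber relation is obtained from an element of the defining ideal of the Rees algebra by
setting the variables of `S` to zero. -/
theorem exists_of_mem_fiberIdeal {u : ι → MvPolynomial σ K} {p : MvPolynomial ι K}
    (hp : p ∈ fiberIdeal u) :
    ∃ q ∈ reesIdeal u, MvPolynomial.map (constantCoeff : MvPolynomial σ K →+* K) q = p := by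
  have h0 : fiberMap u p = 0 := hp
  have hc : (reesMap u).toRingHom.comp C =
      algebraMap (MvPolynomial σ K) (reesAlgebra (Ideal.span (Set.range u))) :=
    (reesMap u).comp_algebraMap
  rw [fiberMap_eq, Ideal.Quotient.eq_zero_iff_mem, ← hc, ← Ideal.map_map,
    Ideal.mem_map_iff_of_surjective (reesMap u).toRingHom (reesMap_surjective u)] at h0
  obtain ⟨q, hq, hqp⟩ := h0
  -- Since `p` maps into `𝔪 R(I)`, its image is that of some `q ∈ 𝔪 T`; the difference lies in `J`,
  -- and `q` vanishes at `x = 0`.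
  refine ⟨MvPolynomial.map C p - q, ?_, ?_⟩
  · exact (RingHom.mem_ker).mpr (by rw [map_sub, ← sub_eq_zero_of_eq hqp.symm]; rfl)
  · have hq0 : MvPolynomial.map (constantCoeff : MvPolynomial σ K →+* K) q = 0 := by
      rw [← RingHom.mem_ker]
      refine Ideal.map_le_iff_le_comap.mpr (Ideal.span_le.mpr ?_) hq
      rintro _ ⟨i, rfl⟩
      simp [RingHom.mem_ker]
    rw [map_sub, hq0, sub_zero, MvPolynomial.map_map]
    convert MvPolynomial.map_id p
    ext; simp

theorem fiberIdeal_eq_of_even {n : ℕ} [NeZero n] (hn : 3 ≤ n) (he : Even n) :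
    fiberIdeal (cyclePathMonomial K n (n - 2)) = Ideal.span {fiberRel K n} := by
  refine le_antisymm (fun p hp => ?_) ?_
  · obtain ⟨q, hq, rfl⟩ := exists_of_mem_fiberIdeal hp
    rw [reesIdeal_eq_of_even hn he, extendToT_span_singleton] at hq
    rw [← Ideal.mem_comap]
    -- At `x = 0` the linear relations vanish and `h` is unchanged.
    refine (sup_le ?_ ?_ : _ ⊔ _ ≤ Ideal.comap _ _) hq
    · rw [linRelIdeal, Ideal.span_le]
      rintro _ ⟨k, -, rfl⟩
      rw [linRel_eq (by omega)]
      simp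
    · rw [Ideal.span_singleton_le_iff_mem, Ideal.mem_comap, MvPolynomial.map_map]
      have : (constantCoeff : MvPolynomial (Fin n) K →+* K).comp C = RingHom.id K := by
        ext; simp
      rw [this, MvPolynomial.map_id]
      exact Ideal.mem_span_singleton_self _
  · rw [Ideal.span_singleton_le_iff_mem]
    have h : reesMap (cyclePathMonomial K n (n - 2)) (MvPolynomial.map C (fiberRel K n)) = 0 :=
      map_fiberRel_mem_reesIdeal (by omega) he
    change fiberMap (cyclePathMonomial K n (n - 2)) (fiberRel K n) = 0
    rw [fiberMap_eq, h, map_zero]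

end FiberRelations

theorem mainTheorem1 (K : Type*) [Field K] (n : ℕ) [NeZero n] (hn : 3 ≤ n) :
    -- the monomials `u_1, …, u_n` generate the ideal `I_{n-2}(C_n)`
    Ideal.span (Set.range (cyclePathMonomial K n (n - 2))) =
        pathIdeal K (SimpleGraph.cycleGraph n) (n - 2) ∧
      -- the defining ideal of the symmetric algebra is `L = (f_1, …, f_n)`
      symIdeal (cyclePathMonomial K n (n - 2)) = linRelIdeal K n ∧
      -- `n` odd: `J = L`
      (Odd n →
        reesIdeal (cyclePathMonomial K n (n - 2)) = linRelIdeal K n ∧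
        IsLinearType (cyclePathMonomial K n (n - 2))) ∧
      -- `n` even: `H = (h)` and `J = L + H T`
      (Even n →
        fiberIdeal (cyclePathMonomial K n (n - 2)) = Ideal.span {fiberRel K n} ∧
        reesIdeal (cyclePathMonomial K n (n - 2)) =
          linRelIdeal K n ⊔ extendToT (Fin n) (Ideal.span {fiberRel K n}) ∧
        IsFiberType (cyclePathMonomial K n (n - 2))) := by
  refine ⟨span_cyclePathMonomial K hn, symIdeal_eq hn, fun ho => ⟨reesIdeal_eq_of_odd hn ho, ?_⟩,
    fun he => ⟨fiberIdeal_eq_of_even hn he, reesIdeal_eq_of_even hn he, ?_⟩⟩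
  · rw [IsLinearType, symIdeal_eq hn, reesIdeal_eq_of_odd hn ho]
  · rw [IsFiberType, symIdeal_eq hn, fiberIdeal_eq_of_even hn he, reesIdeal_eq_of_even hn he]
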